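/- Let $d\ge 2$ and $\gamma>-1$, and let $\mathbb V_0^{d+1}=\{(x,t)\in\mathbb R^d\times\mathbb R:\ \|x\|=t,\ 0\le t\le 1\}$ be the surface of the cone. Let $d\sigma(x,t)$ be its surface measure, normalized so that $$\int_{\mathbb V_0^{d+1}} f(x,t)\,d\sigma(x,t)=\int_0^1 t^{d-1}\int_{\mathbb S^{d-1}} f(t\xi,t)\,d\sigma(\xi)\,dt ,$$ where $d\sigma(\xi)$ is the surface measure of the unit sphere $\mathbb S^{d-1}$. On $\mathbb R[x,t]/\langle \|x\|^2-t^2\rangle$ consider the inner product $$\langle f,g\rangle_{-1,\gamma}=b\int_{\mathbb V_0^{d+1}} f(x,t)g(x,t)\,t^{-1}(1-t)^{\gamma}\,d\sigma(x,t),$$ with $b$ chosen so that $\langle 1,1\rangle_{-1,\gamma}=1$. For $n\in\mathbb N_0$ let $\mathcal V_n$ be the space of orthogonal polynomials of degree $n$, that is, of those $u\in\mathbb R[x,t]/\langle \|x\|^2-t^2\rangle$ that are represented by a polynomial of total degree at most $n$ and satisfy $\langle u,q\rangle_{-1,\gamma}=0$ for every polynomial $q$ of total degree less than $n$. Then, for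 every $n\in\mathbb N_0$, every $u\in\mathcal V_n$ satisfies the differential equation $$D_{-1,\gamma}\,u=-n(n+\gamma+d-1)\,u,$$ where $$D_{-1,\gamma}=t(1-t)\,\partial_t^2+\bigl(d-1-(d+\gamma)t\bigr)\,\partial_t+t^{-1}\Delta_0^{(x)}.$$ Here $D_{-1,\gamma}$ acts on $u$ in the coordinates $x=t\xi$, that is, on the function $(\xi,t)\mapsto u(t\xi,t)$ of $\xi\in\mathbb S^{d-1}$ and $0<t\le 1$: the derivatives $\partial_t$ are taken with $\xi$ fixed, and $\Delta_0^{(x)}$ is the Laplace--Beltrami operator of $\mathbb S^{d-1}$, applied in the variable $\xi$. -/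

import Mathlib

open MeasureTheory Metric Set

namespace ConeOP

noncomputable section

/-- The ideal `⟨‖x‖² - t²⟩` of `ℝ[x, t]`, with `x = (x₁, …, x_d)`. The variable `some i` is `x_i`
and the variable `none` is `t`. -/
def coneIdeal (d : ℕ) : Ideal (MvPolynomial (Option (Fin d)) ℝ) :=
  Ideal.span {(∑ i : Fin d, MvPolynomial.X (some i) ^ 2) - MvPolynomial.X none ^ 2}

/-- The algebra `ℝ[x, t] / ⟨‖x‖² - t²⟩`. -/
abbrev ConePoly (d : ℕ) : Type := MvPolynomial (Option (Fin d)) ℝ ⧸ coneIdeal d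

/-- The elements of `ℝ[x, t] / ⟨‖x‖² - t²⟩` that are represented by a polynomial of total degree
at most `n`. -/
def polyDegreeLE (d n : ℕ) : Submodule ℝ (ConePoly d) :=
  (MvPolynomial.restrictTotalDegree (Option (Fin d)) ℝ n).map
    (Ideal.Quotient.mkₐ ℝ (coneIdeal d)).toLinearMap

lemma eval_eq_zero_of_mem_coneIdeal {d : ℕ} (x : EuclideanSpace ℝ (Fin d)) (t : ℝ)
    (h : ‖x‖ ^ 2 = t ^ 2) (p : MvPolynomial (Option (Fin d)) ℝ) (hp : p ∈ coneIdeal d) :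
    MvPolynomial.eval (fun o : Option (Fin d) => o.elim t (fun i => x i)) p = 0 := by
  have hle : coneIdeal d ≤
      RingHom.ker (MvPolynomial.eval (fun o : Option (Fin d) => o.elim t (fun i => x i))) := by
    rw [coneIdeal, Ideal.span_le, Set.singleton_subset_iff, SetLike.mem_coe, RingHom.mem_ker]
    rw [EuclideanSpace.real_norm_sq_eq] at h
    simp [h]
  exact hle hp

/-- The value of `u ∈ ℝ[x, t] / ⟨‖x‖² - t²⟩` at a point `(x, t)` with `‖x‖² = t²`. -/
def evalAt {d : ℕ} (u : ConePoly d) (x : EuclideanSpace ℝ (Fin d)) (t : ℝ)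
    (h : ‖x‖ ^ 2 = t ^ 2) : ℝ :=
  Ideal.Quotient.lift (coneIdeal d)
    (MvPolynomial.eval (fun o : Option (Fin d) => o.elim t (fun i => x i)))
    (eval_eq_zero_of_mem_coneIdeal x t h) u

/-- The surface `{(x, t) : ‖x‖ = t, 0 ≤ t ≤ 1}` of the cone in `ℝ^d × ℝ`. -/
def coneSurface (d : ℕ) : Set (EuclideanSpace ℝ (Fin d) × ℝ) :=
  {p | ‖p.1‖ = p.2 ∧ 0 ≤ p.2 ∧ p.2 ≤ 1}

/-- The parametrization `(t, ξ) ↦ (t ξ, t)` of the surface of the cone by `[0, 1] × S^{d-1}`. -/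
def coneParam (d : ℕ) (q : Icc (0 : ℝ) 1 × sphere (0 : EuclideanSpace ℝ (Fin d)) 1) :
    coneSurface d :=
  ⟨((q.1 : ℝ) • (q.2 : EuclideanSpace ℝ (Fin d)), (q.1 : ℝ)), by
    refine ⟨?_, q.1.2.1, q.1.2.2⟩
    simp [norm_smul, abs_of_nonneg q.1.2.1]⟩

/-- The measure `dσ(x, t)` on the surface of the cone: the image of `t^{d-1} dt dσ(ξ)` under
`(t, ξ) ↦ (t ξ, t)`, where `dσ(ξ)` is the surface measure of `S^{d-1}`. -/
def coneMeasure (d : ℕ) : Measure (coneSurface d) :=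
  Measure.map (coneParam d)
    (((volume : Measure (Icc (0 : ℝ) 1)).withDensity
        (fun t => ENNReal.ofReal ((t : ℝ) ^ (d - 1)))).prod
      (volume : Measure (EuclideanSpace ℝ (Fin d))).toSphere)

/-- The restriction of `u ∈ ℝ[x, t] / ⟨‖x‖² - t²⟩` to the surface of the cone. -/
def restrictSurface {d : ℕ} (u : ConePoly d) (p : coneSurface d) : ℝ :=
  evalAt u p.1.1 p.1.2 (by rw [p.2.1])

/-- The Jacobi weight `t^β (1 - t)^γ`. -/
def jacobiWeight (β γ t : ℝ) : ℝ := t ^ β * (1 - t) ^ γ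

/-- The constant that normalizes the inner product by `⟨1, 1⟩ = 1`. -/
def normConst (d : ℕ) (β γ : ℝ) : ℝ :=
  (∫ p : coneSurface d, jacobiWeight β γ p.1.2 ∂(coneMeasure d))⁻¹

/-- The inner product `b ∫ f g t^β (1 - t)^γ dσ` on `ℝ[x, t] / ⟨‖x‖² - t²⟩`. -/
def coneInner (d : ℕ) (β γ : ℝ) (f g : ConePoly d) : ℝ :=
  normConst d β γ *
    ∫ p : coneSurface d,
      restrictSurface f p * restrictSurface g p * jacobiWeight β γ p.1.2 ∂(coneMeasure d)

/-- The set `V_n` of orthogonal polynomials of degree `n` for the weight `t^β (1 - t)^γ`: the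
elements of degree at most `n` that are orthogonal to all elements of degree less than `n`. -/
def orthogonalPolys (d : ℕ) (β γ : ℝ) (n : ℕ) : Set (ConePoly d) :=
  {u | u ∈ polyDegreeLE d n ∧ ∀ m < n, ∀ q ∈ polyDegreeLE d m, coneInner d β γ u q = 0}

/-- The Laplace–Beltrami operator of the unit sphere: the Laplacian of the extension
`y ↦ f (y / ‖y‖)` of `f` (homogeneous of degree `0`), restricted to the sphere. -/
def sphereLaplacian {d : ℕ} (f : sphere (0 : EuclideanSpace ℝ (Fin d)) 1 → ℝ)
    (ξ : sphere (0 : EuclideanSpace ℝ (Fin d)) 1) : ℝ :=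
  Laplacian.laplacian
    (fun y : EuclideanSpace ℝ (Fin d) =>
      if h : y = 0 then (0 : ℝ)
      else f ⟨‖y‖⁻¹ • y, by simp [norm_smul, inv_mul_cancel₀ (norm_ne_zero_iff.mpr h)]⟩)
    (ξ : EuclideanSpace ℝ (Fin d))

/-- The operator `t (1 - t) ∂_t² + (d - 1 - (d + γ) t) ∂_t + t⁻¹ Δ₀` on functions `F (ξ, t)` of
`ξ ∈ S^{d-1}` and `t`; here `Δ₀` acts on the variable `ξ`. -/
def coneOperator (d : ℕ) (γ : ℝ) (F : sphere (0 : EuclideanSpace ℝ (Fin d)) 1 → ℝ → ℝ)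
    (ξ : sphere (0 : EuclideanSpace ℝ (Fin d)) 1) (t : ℝ) : ℝ :=
  t * (1 - t) * iteratedDeriv 2 (F ξ) t + ((d : ℝ) - 1 - ((d : ℝ) + γ) * t) * deriv (F ξ) t
    + t⁻¹ * sphereLaplacian (fun η => F η t) ξ

/-- The function `(ξ, t) ↦ u(t ξ, t)`, that is, `u` in the coordinates `x = t ξ`. -/
def inCoords {d : ℕ} (u : ConePoly d) (ξ : sphere (0 : EuclideanSpace ℝ (Fin d)) 1) (t : ℝ) : ℝ :=
  evalAt u (t • (ξ : EuclideanSpace ℝ (Fin d))) t (by simp [norm_smul])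

end

end ConeOP

namespace ConeOP

open MvPolynomial

noncomputable section

/-! The argument is the classical one: an operator that is symmetric for the inner product and
triangular with respect to degree acts on each space of orthogonal polynomials as a scalar. On the
ray `s ↦ (s ξ, s)` the Euler derivation `E` of `(x, t)` acts as `s ∂_s`, so `D_{-1,γ} = t⁻¹ (E² + (d
- 2) E + Δ₀) - E² - (γ + d - 1) E`. The factor `t⁻¹` cancels against a polynomial identity
(`X_none_mul_loweringPart`), and the bracket becomes an operator `loweringPart` on `ℝ[x, t]` that
lowers homogeneous degree by one. Hence `coneOpPoly` lifts `D_{-1,γ}`, and adding `n (n + γ + d -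
1)` to it sends degree at most `n` to degree less than `n`. Symmetry
(`coneFunctional_coneOpPoly_mul`) is checked on homogeneous factors, where the cone integral is a
Beta moment times a sphere integral. Green's formula on the sphere leaves a multiple of the
difference between consecutive moments, and the Beta recurrence makes it vanish. For `p`
representing an orthogonal polynomial, put `w = L p + λ p`, with `L` the lift and `λ = n (n + γ + d
- 1)`. Then `⟨w, w⟩ = ⟨p, L w⟩ + λ ⟨p, w⟩ = 0`, since `w` and `L w` have degree less than `n`.
Definiteness gives `w = 0` on the cone. Only values on the cone enter, so whether `L` descends to
the quotient never has to be discussed. -/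

/-! ### Polynomial lift of the operator and its effect on degrees. -/

/-- The polynomial ring `ℝ[x, t]`; the variable `some i` is `x_i` and the variable `none` is `t`. -/
abbrev AmbientPoly (d : ℕ) : Type := MvPolynomial (Option (Fin d)) ℝ

/-- The Euler derivation `∑ x_i ∂_i` in the variables `x`. -/
def eulerX (d : ℕ) : Derivation ℝ (AmbientPoly d) (AmbientPoly d) :=
  ∑ i : Fin d, (X (some i) : AmbientPoly d) • pderiv (some i)

/-- The Euler derivation `t ∂_t + ∑ x_i ∂_i`. -/
def euler (d : ℕ) : Derivation ℝ (AmbientPoly d) (AmbientPoly d) :=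
  (X none : AmbientPoly d) • pderiv none + eulerX d

/-- The Laplacian `∑ ∂_i²` in the variables `x`. -/
def laplacianX (d : ℕ) : AmbientPoly d →ₗ[ℝ] AmbientPoly d :=
  ∑ i : Fin d, (pderiv (some i)).toLinearMap ∘ₗ (pderiv (some i)).toLinearMap

/-- The differential operator `Δ - E² - (d - 2) E`, with `E` the Euler derivation in `x`, which
acts on the sphere as the Laplace–Beltrami operator. -/
def spherePart (d : ℕ) : AmbientPoly d →ₗ[ℝ] AmbientPoly d :=
  laplacianX d - (eulerX d).toLinearMap ∘ₗ (eulerX d).toLinearMap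
    - ((d : ℝ) - 2) • (eulerX d).toLinearMap

/-- The part of the cone operator that lowers the degree by one. -/
def loweringPart (d : ℕ) : AmbientPoly d →ₗ[ℝ] AmbientPoly d :=
  LinearMap.mulLeft ℝ (X none) ∘ₗ laplacianX d
    + LinearMap.mulLeft ℝ (X none) ∘ₗ (pderiv none).toLinearMap ∘ₗ (pderiv none).toLinearMap
    + ((d : ℝ) - 1) • (pderiv none).toLinearMap
    + (2 : ℝ) • (eulerX d).toLinearMap ∘ₗ (pderiv none).toLinearMap

/-- A lift of the operator `D_{-1,γ}` to `ℝ[x, t]`. -/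
def coneOpPoly (d : ℕ) (γ : ℝ) : AmbientPoly d →ₗ[ℝ] AmbientPoly d :=
  loweringPart d - (euler d).toLinearMap ∘ₗ (euler d).toLinearMap
    - (γ + d - 1) • (euler d).toLinearMap

variable {d : ℕ}

lemma eulerX_apply (p : AmbientPoly d) :
    eulerX d p = ∑ i : Fin d, X (some i) * pderiv (some i) p := by
  have h := congrFun (map_sum (Derivation.coeFnAddMonoidHom (R := ℝ) (A := AmbientPoly d)
    (M := AmbientPoly d)) (fun i : Fin d => (X (some i) : AmbientPoly d) • pderiv (some i))
    Finset.univ) p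
  rw [Finset.sum_apply] at h
  exact h

lemma euler_apply (p : AmbientPoly d) :
    euler d p = X none * pderiv none p + eulerX d p := rfl

lemma laplacianX_apply (p : AmbientPoly d) :
    laplacianX d p = ∑ i : Fin d, pderiv (some i) (pderiv (some i) p) := by
  simp [laplacianX]

lemma spherePart_apply (p : AmbientPoly d) :
    spherePart d p = laplacianX d p - eulerX d (eulerX d p) - ((d : ℝ) - 2) • eulerX d p := rfl

lemma loweringPart_apply (p : AmbientPoly d) :
    loweringPart d p = X none * laplacianX d p + X none * pderiv none (pderiv none p)
      + ((d : ℝ) - 1) • pderiv none p + (2 : ℝ) • eulerX d (pderiv none p) := rfl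

lemma coneOpPoly_apply (γ : ℝ) (p : AmbientPoly d) :
    coneOpPoly d γ p = loweringPart d p - euler d (euler d p) - (γ + d - 1) • euler d p := rfl

lemma eulerX_X_none : eulerX d (X none) = 0 := by
  simp [eulerX_apply, pderiv_X]

lemma eulerX_X_some (i : Fin d) : eulerX d (X (some i)) = X (some i) := by
  simp [eulerX_apply, pderiv_X, Pi.single_apply]

/-- The commutator of two derivations is again a derivation, so it is determined by its values on
the variables, all of which are zero. -/
lemma pderiv_comm {σ : Type*} (i j : σ) (p : MvPolynomial σ ℝ) :
    pderiv i (pderiv j p) = pderiv j (pderiv i p) := by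
  classical
  let D : Derivation ℝ (MvPolynomial σ ℝ) (MvPolynomial σ ℝ) :=
    ⁅(pderiv i : Derivation ℝ (MvPolynomial σ ℝ) (MvPolynomial σ ℝ)),
      (pderiv j : Derivation ℝ (MvPolynomial σ ℝ) (MvPolynomial σ ℝ))⁆
  have h : D = 0 := by
    apply MvPolynomial.derivation_ext
    intro k
    simp only [D, Derivation.commutator_apply, pderiv_X, Derivation.coe_zero, Pi.zero_apply,
      Pi.single_apply]
    split_ifs <;> simp
  have h' := congrArg (fun D => D p) h
  simpa [D, Derivation.commutator_apply, sub_eq_zero] using h'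

lemma pderiv_none_eulerX (p : AmbientPoly d) :
    pderiv none (eulerX d p) = eulerX d (pderiv none p) := by
  simp only [eulerX_apply, map_sum, Derivation.leibniz, pderiv_X, smul_eq_mul]
  refine Finset.sum_congr rfl fun i _ => ?_
  simp [pderiv_comm none (some i)]

lemma pderiv_none_euler (p : AmbientPoly d) :
    pderiv none (euler d p) =
      pderiv none p + X none * pderiv none (pderiv none p) + eulerX d (pderiv none p) := by
  simp only [euler_apply, map_add, Derivation.leibniz, pderiv_X_self, pderiv_none_eulerX,
    smul_eq_mul]
  ring

/-- `t R = t² Δ - E_x² - (d - 2) E_x + E² + (d - 2) E`, with `E_x` and `E` the Euler derivations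
in `x` and in `(x, t)`. -/
lemma X_none_mul_loweringPart (p : AmbientPoly d) :
    X none * loweringPart d p = X none ^ 2 * laplacianX d p - eulerX d (eulerX d p)
      - ((d : ℝ) - 2) • eulerX d p + euler d (euler d p) + ((d : ℝ) - 2) • euler d p := by
  have h : eulerX d (euler d p) = X none * eulerX d (pderiv none p) + eulerX d (eulerX d p) := by
    simp [euler_apply, Derivation.leibniz, eulerX_X_none]
  rw [euler_apply (euler d p), pderiv_none_euler, h, loweringPart_apply, euler_apply]
  simp only [smul_eq_C_mul, map_sub, map_one, map_ofNat]
  ring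

lemma euler_of_isHomogeneous {p : AmbientPoly d} {m : ℕ} (hp : p.IsHomogeneous m) :
    euler d p = (m : ℝ) • p := by
  rw [euler_apply, eulerX_apply,
    ← Fintype.sum_option (fun o : Option (Fin d) => (X o : AmbientPoly d) * pderiv o p),
    hp.sum_X_mul_pderiv, Nat.cast_smul_eq_nsmul]

/-- The degree of a monomial in the variables `x`. -/
def xDegree (s : Option (Fin d) →₀ ℕ) : ℕ := ∑ i : Fin d, s (some i)

lemma eulerX_monomial (s : Option (Fin d) →₀ ℕ) (a : ℝ) :
    eulerX d (monomial s a) = (xDegree s : ℝ) • monomial s a := by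
  simp only [eulerX_apply, X_mul_pderiv_monomial, xDegree, ← Finset.sum_smul,
    Nat.cast_smul_eq_nsmul]

lemma coneOpPoly_of_isHomogeneous (γ : ℝ) {p : AmbientPoly d} {m : ℕ} (hp : p.IsHomogeneous m) :
    coneOpPoly d γ p = loweringPart d p - ((m : ℝ) * (m + γ + d - 1)) • p := by
  simp only [coneOpPoly_apply, euler_of_isHomogeneous hp, Derivation.map_smul, smul_smul]
  rw [sub_sub, ← add_smul]
  ring_nf

lemma isHomogeneous_eulerX {p : AmbientPoly d} {m : ℕ} (hp : p.IsHomogeneous m) :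
    (eulerX d p).IsHomogeneous m := by
  rw [eulerX_apply]
  refine IsHomogeneous.sum _ _ _ fun i _ => ?_
  -- The degree `m - 1` of a derivative is truncated at `m = 0`, so constants are treated apart.
  rcases m with _ | m
  · rw [← totalDegree_zero_iff_isHomogeneous, totalDegree_eq_zero_iff_eq_C] at hp
    rw [hp, pderiv_C, mul_zero]
    exact isHomogeneous_zero _ _ _
  · simpa [add_comm] using (isHomogeneous_X ℝ (some i)).mul (hp.pderiv (i := some i))

lemma loweringPart_of_isHomogeneous_zero {p : AmbientPoly d} (hp : p.IsHomogeneous 0) :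
    loweringPart d p = 0 := by
  rw [← totalDegree_zero_iff_isHomogeneous, totalDegree_eq_zero_iff_eq_C] at hp
  rw [hp]
  simp [loweringPart_apply, laplacianX_apply]

lemma isHomogeneous_X_mul_pderiv_pderiv {p : AmbientPoly d} {m : ℕ}
    (hp : p.IsHomogeneous (m + 1)) (o : Option (Fin d)) :
    (X none * pderiv o (pderiv o p)).IsHomogeneous m := by
  have h := hp.pderiv (i := o)
  rw [Nat.add_sub_cancel] at h
  rcases m with _ | m
  · rw [← totalDegree_zero_iff_isHomogeneous, totalDegree_eq_zero_iff_eq_C] at h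
    rw [h, pderiv_C, mul_zero]
    exact isHomogeneous_zero _ _ _
  · simpa [add_comm] using (isHomogeneous_X ℝ none).mul (h.pderiv (i := o))

lemma isHomogeneous_loweringPart {p : AmbientPoly d} {m : ℕ} (hp : p.IsHomogeneous (m + 1)) :
    (loweringPart d p).IsHomogeneous m := by
  have hn := hp.pderiv (i := none)
  rw [Nat.add_sub_cancel] at hn
  rw [loweringPart_apply, laplacianX_apply, Finset.mul_sum]
  simp only [smul_eq_C_mul]
  refine ((IsHomogeneous.add (IsHomogeneous.sum _ _ _ fun i _ => ?_) ?_).add ?_).add ?_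
  · exact isHomogeneous_X_mul_pderiv_pderiv hp _
  · exact isHomogeneous_X_mul_pderiv_pderiv hp _
  · exact hn.C_mul _
  · exact (isHomogeneous_eulerX hn).C_mul _

lemma loweringPart_mem_of_isHomogeneous {p : AmbientPoly d} {m n : ℕ} (hp : p.IsHomogeneous m)
    (h : m ≤ n + 1) : loweringPart d p ∈ restrictTotalDegree (Option (Fin d)) ℝ n := by
  rcases m with _ | m
  · rw [loweringPart_of_isHomogeneous_zero hp]
    exact zero_mem _
  · rw [mem_restrictTotalDegree]
    exact (isHomogeneous_loweringPart hp).totalDegree_le.trans (by omega)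

lemma totalDegree_induction {n : ℕ} {P : AmbientPoly d → Prop} (h0 : P 0)
    (hadd : ∀ p q, P p → P q → P (p + q))
    (hom : ∀ m ≤ n, ∀ p : AmbientPoly d, p.IsHomogeneous m → P p)
    {p : AmbientPoly d} (hp : p ∈ restrictTotalDegree (Option (Fin d)) ℝ n) : P p := by
  rw [mem_restrictTotalDegree] at hp
  rw [← sum_homogeneousComponent p]
  refine Finset.sum_induction _ P hadd h0 fun m hm => ?_
  exact hom m (by rw [Finset.mem_range] at hm; omega) _ (homogeneousComponent_isHomogeneous m p)

lemma coneOpPoly_mem (γ : ℝ) {n : ℕ} {p : AmbientPoly d}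
    (hp : p ∈ restrictTotalDegree (Option (Fin d)) ℝ n) :
    coneOpPoly d γ p ∈ restrictTotalDegree (Option (Fin d)) ℝ n := by
  refine totalDegree_induction (P := fun p => coneOpPoly d γ p ∈
    restrictTotalDegree (Option (Fin d)) ℝ n) ?_ (fun p q h1 h2 => ?_) (fun m hm p hp => ?_) hp
  · simp
  · rw [map_add]
    exact add_mem h1 h2
  · rw [coneOpPoly_of_isHomogeneous γ hp]
    refine sub_mem (loweringPart_mem_of_isHomogeneous hp (by omega)) (Submodule.smul_mem _ _ ?_)
    rw [mem_restrictTotalDegree]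
    exact hp.totalDegree_le.trans hm

/-- The scalar is chosen to cancel the diagonal term on the component of degree `n + 1`; what
remains of that component is its image under `loweringPart`. -/
lemma coneOpPoly_add_smul_mem (γ : ℝ) {n : ℕ} {p : AmbientPoly d}
    (hp : p ∈ restrictTotalDegree (Option (Fin d)) ℝ (n + 1)) :
    coneOpPoly d γ p + (((n + 1 : ℕ) : ℝ) * ((n + 1 : ℕ) + γ + d - 1)) • p
      ∈ restrictTotalDegree (Option (Fin d)) ℝ n := by
  refine totalDegree_induction (P := fun p => coneOpPoly d γ p +
    (((n + 1 : ℕ) : ℝ) * ((n + 1 : ℕ) + γ + d - 1)) • p ∈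
    restrictTotalDegree (Option (Fin d)) ℝ n) ?_ (fun p q h1 h2 => ?_) (fun m hm p hp => ?_) hp
  · simp
  · rw [map_add, smul_add, add_add_add_comm]
    exact add_mem h1 h2
  · rw [coneOpPoly_of_isHomogeneous γ hp]
    rcases hm.eq_or_lt with rfl | hm
    · rw [sub_add_cancel]
      exact loweringPart_mem_of_isHomogeneous hp le_rfl
    · have hp' : p ∈ restrictTotalDegree (Option (Fin d)) ℝ n := by
        rw [mem_restrictTotalDegree]
        exact hp.totalDegree_le.trans (by omega)
      exact add_mem (sub_mem (loweringPart_mem_of_isHomogeneous hp (by omega))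
        (Submodule.smul_mem _ _ hp')) (Submodule.smul_mem _ _ hp')

/-! ### Evaluation on the cone and derivatives along its rays. -/

/-- The value at `(x, t)` of a polynomial. -/
def polyEval (x : EuclideanSpace ℝ (Fin d)) (t : ℝ) : AmbientPoly d →ₐ[ℝ] ℝ :=
  MvPolynomial.aeval (fun o : Option (Fin d) => o.elim t (fun i => x i))

@[simp]
lemma polyEval_X_none (x : EuclideanSpace ℝ (Fin d)) (t : ℝ) : polyEval x t (X none) = t := by
  simp [polyEval]

@[simp]
lemma polyEval_X_some (x : EuclideanSpace ℝ (Fin d)) (t : ℝ) (i : Fin d) :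
    polyEval x t (X (some i)) = x i := by
  simp [polyEval]

lemma evalAt_mk (p : AmbientPoly d) (x : EuclideanSpace ℝ (Fin d)) (t : ℝ)
    (h : ‖x‖ ^ 2 = t ^ 2) :
    evalAt (Ideal.Quotient.mk (coneIdeal d) p) x t h = polyEval x t p := by
  rw [evalAt, Ideal.Quotient.lift_mk, polyEval, aeval_eq_eval]

lemma inCoords_mk (p : AmbientPoly d) (ξ : sphere (0 : EuclideanSpace ℝ (Fin d)) 1) (t : ℝ) :
    inCoords (Ideal.Quotient.mk (coneIdeal d) p) ξ t
      = polyEval (t • (ξ : EuclideanSpace ℝ (Fin d))) t p :=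
  evalAt_mk p _ _ _

lemma polyEval_eulerX (x : EuclideanSpace ℝ (Fin d)) (t : ℝ) (p : AmbientPoly d) :
    polyEval x t (eulerX d p) = ∑ i, x i * polyEval x t (pderiv (some i) p) := by
  simp [eulerX_apply]

lemma polyEval_euler (x : EuclideanSpace ℝ (Fin d)) (t : ℝ) (p : AmbientPoly d) :
    polyEval x t (euler d p) =
      t * polyEval x t (pderiv none p) + ∑ i, x i * polyEval x t (pderiv (some i) p) := by
  simp [euler_apply, polyEval_eulerX]

lemma hasDerivAt_aeval {σ : Type*} [Fintype σ] {z : ℝ → σ → ℝ} {z' : σ → ℝ} {s : ℝ}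
    (hz : ∀ o, HasDerivAt (fun r => z r o) (z' o) s) (p : MvPolynomial σ ℝ) :
    HasDerivAt (fun r => MvPolynomial.aeval (z r) p)
      (∑ o, z' o * MvPolynomial.aeval (z s) (pderiv o p)) s := by
  classical
  induction p using MvPolynomial.induction_on with
  | C a => simpa using hasDerivAt_const s a
  | add p q hp hq => simpa [mul_add, Finset.sum_add_distrib] using hp.fun_add hq
  | mul_X p o hp =>
    simp only [map_mul, aeval_X]
    refine (hp.mul (hz o)).congr_deriv ?_
    simp only [Derivation.leibniz, smul_eq_mul, map_add, map_mul, aeval_X, pderiv_X,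
      Pi.single_apply, mul_add, Finset.sum_add_distrib, Finset.sum_mul]
    rw [add_comm]
    congr 1
    · simp [apply_ite (MvPolynomial.aeval (z s)), mul_comm]
    · exact Finset.sum_congr rfl fun _ _ => by ring

lemma hasDerivAt_polyEval {x : ℝ → EuclideanSpace ℝ (Fin d)} {x' : Fin d → ℝ} {t : ℝ → ℝ}
    {t' s : ℝ} (hx : ∀ i, HasDerivAt (fun r => x r i) (x' i) s) (ht : HasDerivAt t t' s)
    (p : AmbientPoly d) :
    HasDerivAt (fun r => polyEval (x r) (t r) p)
      (t' * polyEval (x s) (t s) (pderiv none p)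
        + ∑ i, x' i * polyEval (x s) (t s) (pderiv (some i) p)) s := by
  have h := hasDerivAt_aeval (z := fun r (o : Option (Fin d)) => o.elim (t r) (fun i => x r i))
    (z' := fun o => o.elim t' x') (s := s) (by rintro (_ | i); exacts [ht, hx i]) p
  rw [Fintype.sum_option] at h
  exact h

/-- Along a ray of the cone, `s ∂_s` acts as the Euler derivation. -/
lemma hasDerivAt_polyEval_smul (x : EuclideanSpace ℝ (Fin d)) {s : ℝ} (hs : s ≠ 0)
    (p : AmbientPoly d) :
    HasDerivAt (fun r => polyEval (r • x) r p) (s⁻¹ * polyEval (s • x) s (euler d p)) s := by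
  refine (hasDerivAt_polyEval (x := fun r => r • x) (x' := fun i => x i) (t := fun r => r)
    (fun i => by simpa using (hasDerivAt_id s).mul_const (x i)) (hasDerivAt_id s) p).congr_deriv ?_
  rw [polyEval_euler, mul_add, inv_mul_cancel_left₀ hs, one_mul, Finset.mul_sum]
  congr 1
  refine Finset.sum_congr rfl fun i _ => ?_
  simp only [PiLp.smul_apply, smul_eq_mul]
  field_simp

lemma deriv_polyEval_smul (x : EuclideanSpace ℝ (Fin d)) {s : ℝ} (hs : s ≠ 0)
    (p : AmbientPoly d) :
    deriv (fun r => polyEval (r • x) r p) s = s⁻¹ * polyEval (s • x) s (euler d p) :=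
  (hasDerivAt_polyEval_smul x hs p).deriv

lemma iteratedDeriv_two_polyEval_smul (x : EuclideanSpace ℝ (Fin d)) {s : ℝ} (hs : s ≠ 0)
    (p : AmbientPoly d) :
    iteratedDeriv 2 (fun r => polyEval (r • x) r p) s =
      (s ^ 2)⁻¹ * (polyEval (s • x) s (euler d (euler d p)) - polyEval (s • x) s (euler d p)) := by
  rw [iteratedDeriv_succ, iteratedDeriv_one]
  have h : deriv (fun r => polyEval (r • x) r p) =ᶠ[nhds s]
      fun r => r⁻¹ * polyEval (r • x) r (euler d p) := by
    filter_upwards [isOpen_ne.mem_nhds hs] with r hr using deriv_polyEval_smul x hr p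
  rw [h.deriv_eq, ((hasDerivAt_inv hs).fun_mul (hasDerivAt_polyEval_smul x hs _)).deriv]
  field_simp
  ring

lemma contDiff_aeval {E : Type*} [NormedAddCommGroup E] [NormedSpace ℝ E] {n : WithTop ℕ∞}
    {σ : Type*} {z : E → σ → ℝ} {y : E} (hz : ∀ o, ContDiffAt ℝ n (fun r => z r o) y)
    (p : MvPolynomial σ ℝ) : ContDiffAt ℝ n (fun r => MvPolynomial.aeval (z r) p) y := by
  induction p using MvPolynomial.induction_on with
  | C a => simpa using contDiffAt_const
  | add p q hp hq => simpa using hp.add hq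
  | mul_X p o hp => simpa using hp.mul (hz o)

lemma contDiffAt_polyEval {E : Type*} [NormedAddCommGroup E] [NormedSpace ℝ E]
    {n : WithTop ℕ∞} {x : E → EuclideanSpace ℝ (Fin d)} {t : E → ℝ} {y : E}
    (hx : ContDiffAt ℝ n x y) (ht : ContDiffAt ℝ n t y) (p : AmbientPoly d) :
    ContDiffAt ℝ n (fun r => polyEval (x r) (t r) p) y := by
  refine contDiff_aeval (z := fun r (o : Option (Fin d)) => o.elim (t r) (fun i => x r i))
    (fun o => ?_) p
  cases o with
  | none => exact ht
  | some i => exact (contDiffAt_euclidean.1 hx) i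

/-! ### The Laplace–Beltrami operator on polynomials. -/

lemma iteratedFDeriv_two_eq_iteratedDeriv {E : Type*} [NormedAddCommGroup E] [NormedSpace ℝ E]
    {f : E → ℝ} {y : E} (hf : ContDiffAt ℝ 2 f y) (v : E) :
    iteratedFDeriv ℝ 2 f y ![v, v] = iteratedDeriv 2 (fun s : ℝ => f (y + s • v)) 0 := by
  have hline (s : ℝ) : HasDerivAt (fun s : ℝ => y + s • v) v s := by
    simpa using ((hasDerivAt_id s).smul_const v).const_add y
  have h0 : Filter.Tendsto (fun s : ℝ => y + s • v) (nhds 0) (nhds y) := by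
    simpa using (hline 0).continuousAt.tendsto
  have hd : deriv (fun s : ℝ => f (y + s • v)) =ᶠ[nhds 0]
      fun s => fderiv ℝ f (y + s • v) v := by
    have h1 : ∀ᶠ z in nhds y, DifferentiableAt ℝ f z :=
      (hf.eventually (by simp)).mono fun z hz => hz.differentiableAt (by simp)
    filter_upwards [h0.eventually h1] with s hs
    exact (hs.hasFDerivAt.comp_hasDerivAt s (hline s)).deriv
  have h2 : DifferentiableAt ℝ (fderiv ℝ f) (y + (0 : ℝ) • v) := by
    rw [zero_smul, add_zero]
    exact (hf.fderiv_right (m := 1) (by norm_num)).differentiableAt (by simp)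
  rw [iteratedFDeriv_two_apply, iteratedDeriv_succ, iteratedDeriv_one, hd.deriv_eq]
  have h3 : HasDerivAt (fun s : ℝ => fderiv ℝ f (y + s • v))
      (fderiv ℝ (fderiv ℝ f) (y + (0 : ℝ) • v) v) 0 :=
    h2.hasFDerivAt.comp_hasDerivAt (0 : ℝ) (hline 0)
  have h4 := (h3.clm_apply (hasDerivAt_const (0 : ℝ) v)).deriv
  rw [h4]
  simp

/-- Here `t` stays fixed and only `x` is scaled, so the exponent is `xDegree` and not the total
degree. -/
lemma polyEval_smul_monomial (c t a : ℝ) (x : EuclideanSpace ℝ (Fin d))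
    (s : Option (Fin d) →₀ ℕ) :
    polyEval (c • x) t (monomial s a) = c ^ xDegree s * polyEval x t (monomial s a) := by
  simp only [polyEval, aeval_monomial, Finsupp.prod_fintype, Fintype.prod_option, pow_zero,
    implies_true, Option.elim, PiLp.smul_apply, smul_eq_mul, mul_pow, Finset.prod_mul_distrib,
    xDegree, Finset.prod_pow_eq_pow_sum]
  ring

lemma norm_add_smul_single_sq {x : EuclideanSpace ℝ (Fin d)} (hx : ‖x‖ = 1) (i : Fin d) (s : ℝ) :
    ‖x + s • EuclideanSpace.single i (1 : ℝ)‖ ^ 2 = 1 + 2 * s * x i + s ^ 2 := by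
  rw [norm_add_sq_real, hx, norm_smul, inner_smul_right, EuclideanSpace.inner_single_right]
  simp
  ring

lemma hasDerivAt_polyEval_line (x : EuclideanSpace ℝ (Fin d)) (t s : ℝ) (i : Fin d)
    (p : AmbientPoly d) :
    HasDerivAt (fun r : ℝ => polyEval (t • (x + r • EuclideanSpace.single i (1 : ℝ))) t p)
      (t * polyEval (t • (x + s • EuclideanSpace.single i (1 : ℝ))) t (pderiv (some i) p)) s := by
  classical
  refine (hasDerivAt_polyEval (x' := fun j => if j = i then t else 0) (t' := 0) (fun j => ?_)
    (hasDerivAt_const s t) p).congr_deriv (by simp)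
  have := (((hasDerivAt_id s).mul_const (if j = i then (1 : ℝ) else 0)).const_add (x j)).const_mul t
  refine (this.congr_deriv (by simp)).congr_of_eventuallyEq (Filter.Eventually.of_forall fun r => ?_)
  simp only [PiLp.smul_apply, PiLp.add_apply, PiLp.single_apply, smul_eq_mul, id]

/-- The second derivative along a coordinate line of the extension, homogeneous of degree `0`,
of a monomial from the sphere. -/
lemma iteratedDeriv_two_homogeneous_extension {x : EuclideanSpace ℝ (Fin d)} (hx : ‖x‖ = 1)
    (t : ℝ) (i : Fin d) (m : Option (Fin d) →₀ ℕ) (a : ℝ) :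
    iteratedDeriv 2 (fun s : ℝ => polyEval (t • (‖x + s • EuclideanSpace.single i (1 : ℝ)‖⁻¹ •
        (x + s • EuclideanSpace.single i (1 : ℝ)))) t (monomial m a)) 0 =
      t ^ 2 * polyEval (t • x) t (pderiv (some i) (pderiv (some i) (monomial m a)))
        - 2 * xDegree m * (t * x i * polyEval (t • x) t (pderiv (some i) (monomial m a)))
        + (xDegree m * (xDegree m + 2) * x i ^ 2 - xDegree m)
          * polyEval (t • x) t (monomial m a) := by
  set k : ℝ := (xDegree m : ℝ) with hk
  set p : AmbientPoly d := monomial m a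
  set F : AmbientPoly d → ℝ → ℝ := fun q s =>
    polyEval (t • (x + s • EuclideanSpace.single i (1 : ℝ))) t q with hF
  have hF' (q : AmbientPoly d) (s : ℝ) : HasDerivAt (F q) (t * F (pderiv (some i) q) s) s :=
    hasDerivAt_polyEval_line x t s i q
  -- `N` is the squared norm along the line. For a monomial of degree `k` in `x`, the extension of
  -- degree `0` is `N ^ (-k / 2)` times the monomial, a product that is differentiated twice at `s =
  -- 0`.
  set N : ℝ → ℝ := fun s => 1 + 2 * s * x i + s ^ 2 with hN
  have hN' (s : ℝ) : HasDerivAt N (2 * x i + 2 * s) s := by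
    have h := ((((hasDerivAt_id s).const_mul 2).mul_const (x i)).const_add 1).add
      ((hasDerivAt_id s).pow 2)
    exact h.congr_deriv (by simp)
  have hpos : ∀ᶠ s in nhds (0 : ℝ), 0 < N s := by
    refine (hN' 0).continuousAt.eventually (lt_mem_nhds ?_)
    simp [hN]
  have hrpow (c : ℝ) {s : ℝ} (hs : 0 < N s) :
      HasDerivAt (fun r => N r ^ c) ((2 * x i + 2 * s) * c * N s ^ (c - 1)) s :=
    (hN' s).rpow_const (Or.inl hs.ne')
  have heq : (fun s : ℝ => polyEval (t • (‖x + s • EuclideanSpace.single i (1 : ℝ)‖⁻¹ •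
      (x + s • EuclideanSpace.single i (1 : ℝ)))) t p) =ᶠ[nhds 0]
      fun s => N s ^ (-k / 2) * F p s := by
    filter_upwards [hpos] with s hs
    rw [smul_comm, polyEval_smul_monomial]
    congr 1
    have h1 : ‖x + s • EuclideanSpace.single i (1 : ℝ)‖ = N s ^ (1 / 2 : ℝ) := by
      rw [← Real.sqrt_eq_rpow, eq_comm, Real.sqrt_eq_iff_eq_sq hs.le (norm_nonneg _),
        norm_add_smul_single_sq hx]
    rw [h1, ← Real.rpow_neg hs.le, ← Real.rpow_natCast, ← Real.rpow_mul hs.le]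
    congr 1
    rw [← hk]
    ring
  have hderiv : deriv (fun s => N s ^ (-k / 2) * F p s) =ᶠ[nhds 0] fun s =>
      (2 * x i + 2 * s) * (-k / 2) * N s ^ (-k / 2 - 1) * F p s
        + N s ^ (-k / 2) * (t * F (pderiv (some i) p) s) := by
    filter_upwards [hpos] with s hs using ((hrpow _ hs).mul (hF' p s)).deriv
  have h0 := hpos.self_of_nhds
  have hlin : HasDerivAt (fun s : ℝ => (2 * x i + 2 * s) * (-k / 2)) (2 * (-k / 2)) 0 := by
    have := (((hasDerivAt_id (0 : ℝ)).const_mul 2).const_add (2 * x i)).mul_const (-k / 2)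
    exact this.congr_deriv (by simp)
  have hsecond := ((hlin.fun_mul (hrpow (-k / 2 - 1) h0)).fun_mul (hF' p 0)).fun_add
    ((hrpow (-k / 2) h0).fun_mul ((hF' (pderiv (some i) p) 0).const_mul t))
  rw [heq.iteratedDeriv_eq, iteratedDeriv_succ, iteratedDeriv_one, hderiv.deriv_eq, hsecond.deriv]
  simp only [hF, hN, zero_smul, add_zero, mul_zero, zero_mul, ne_eq, OfNat.ofNat_ne_zero,
    not_false_eq_true, zero_pow, Real.one_rpow]
  ring

lemma sphereLaplacian_eq (t : ℝ) (p : AmbientPoly d)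
    (ξ : sphere (0 : EuclideanSpace ℝ (Fin d)) 1) :
    sphereLaplacian (fun η => polyEval (t • (η : EuclideanSpace ℝ (Fin d))) t p) ξ =
      Laplacian.laplacian (fun y : EuclideanSpace ℝ (Fin d) => polyEval (t • (‖y‖⁻¹ • y)) t p)
        (ξ : EuclideanSpace ℝ (Fin d)) := by
  refine (InnerProductSpace.laplacian_congr_nhds ?_).eq_of_nhds
  filter_upwards [isOpen_ne.mem_nhds (ne_zero_of_mem_unit_sphere ξ)] with y hy
  rw [dif_neg hy]

lemma contDiffAt_homogeneous_extension (t : ℝ) (p : AmbientPoly d)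
    {x : EuclideanSpace ℝ (Fin d)} (hx : x ≠ 0) :
    ContDiffAt ℝ 2 (fun y : EuclideanSpace ℝ (Fin d) => polyEval (t • (‖y‖⁻¹ • y)) t p) x := by
  refine contDiffAt_polyEval ?_ contDiffAt_const p
  exact (((contDiffAt_norm ℝ hx).inv (norm_ne_zero_iff.2 hx)).smul contDiffAt_id).const_smul t

/-- Both sides are linear in `p`, so monomials suffice. Summing the second derivatives over `i` with
`∑ x_i² = 1` gives `t² Δ p - 2 k² p + (k (k + 2) - d k) p`, which is `t² Δ p - k² p - (d - 2) k p`,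
and `E_x` acts on the monomial as `k`. -/
lemma laplacian_homogeneous_extension (t : ℝ) (p : AmbientPoly d)
    {x : EuclideanSpace ℝ (Fin d)} (hx : ‖x‖ = 1) :
    Laplacian.laplacian (fun y : EuclideanSpace ℝ (Fin d) => polyEval (t • (‖y‖⁻¹ • y)) t p) x =
      polyEval (t • x) t (X none ^ 2 * laplacianX d p - eulerX d (eulerX d p)
        - ((d : ℝ) - 2) • eulerX d p) := by
  have hx0 : x ≠ 0 := by rintro rfl; simp at hx
  induction p using MvPolynomial.induction_on' with
  | add p q hp hq =>
    have h := (contDiffAt_homogeneous_extension t p hx0).laplacian_add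
      (contDiffAt_homogeneous_extension t q hx0)
    rw [hp, hq, ← map_add] at h
    simp only [map_add]
    refine h.trans ?_
    congr 1
    simp only [mul_add, smul_add]
    abel
  | monomial m a =>
    rw [InnerProductSpace.laplacian_eq_iteratedFDeriv_orthonormalBasis _
      (EuclideanSpace.basisFun (Fin d) ℝ)]
    have hterm (i : Fin d) := (iteratedFDeriv_two_eq_iteratedDeriv
      (contDiffAt_homogeneous_extension t (monomial m a) hx0)
      (EuclideanSpace.single i (1 : ℝ))).trans (iteratedDeriv_two_homogeneous_extension hx t i m a)
    simp only [EuclideanSpace.basisFun_apply, hterm]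
    have hE := polyEval_eulerX (t • x) t (monomial m a)
    have hsq : ∑ i, x i ^ 2 = 1 := by
      rw [← EuclideanSpace.real_norm_sq_eq, hx, one_pow]
    simp only [eulerX_monomial, map_smul, smul_eq_mul, PiLp.smul_apply] at hE
    rw [Finset.sum_add_distrib, Finset.sum_sub_distrib, ← Finset.mul_sum, ← Finset.mul_sum,
      ← Finset.sum_mul, Finset.sum_sub_distrib, ← Finset.mul_sum, hsq, ← hE, eulerX_monomial,
      Derivation.map_smul, eulerX_monomial, laplacianX_apply]
    simp only [map_sub, map_mul, map_smul, map_pow, polyEval_X_none, map_sum, smul_eq_mul,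
      Finset.sum_const, Finset.card_univ, Fintype.card_fin, nsmul_eq_mul]
    ring

/-- The polynomial operator `coneOpPoly` represents `D_{-1,γ}` on the cone. -/
theorem coneOperator_inCoords_mk (γ : ℝ) (p : AmbientPoly d)
    (ξ : sphere (0 : EuclideanSpace ℝ (Fin d)) 1) {t : ℝ} (ht : t ≠ 0) :
    coneOperator d γ (inCoords (Ideal.Quotient.mk (coneIdeal d) p)) ξ t =
      polyEval (t • (ξ : EuclideanSpace ℝ (Fin d))) t (coneOpPoly d γ p) := by
  have hin : inCoords (Ideal.Quotient.mk (coneIdeal d) p) =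
      fun (η : sphere (0 : EuclideanSpace ℝ (Fin d)) 1) s =>
        polyEval (s • (η : EuclideanSpace ℝ (Fin d))) s p := by
    ext η s
    exact inCoords_mk p η s
  have hR := congrArg (polyEval (t • (ξ : EuclideanSpace ℝ (Fin d))) t)
    (X_none_mul_loweringPart p)
  rw [coneOperator, hin, sphereLaplacian_eq,
    laplacian_homogeneous_extension t p (norm_eq_of_mem_sphere ξ),
    iteratedDeriv_two_polyEval_smul _ ht, deriv_polyEval_smul _ ht, coneOpPoly_apply]
  simp only [map_sub, map_add, map_mul, map_smul, smul_eq_mul, polyEval_X_none] at hR ⊢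
  -- After multiplication by `t`, the lowering part enters only through `t R`, which `hR` expresses
  -- by Euler derivations and `Δ`.
  rw [← mul_right_inj' ht]
  field_simp
  linear_combination (-1 : ℝ) * hR

/-! ### Gaussian integrals, the divergence theorem and Green's formula on the sphere. -/

/-- The moments `∫_0^∞ r^a e^{-r²} dr`. -/
def gaussMoment (a : ℕ) : ℝ := ∫ r in Ioi (0 : ℝ), r ^ a * Real.exp (-r ^ 2)

lemma gaussMoment_eq (a : ℕ) : gaussMoment a = 1 / 2 * Real.Gamma ((a + 1) / 2) := by
  rw [gaussMoment, ← integral_rpow_mul_exp_neg_rpow two_pos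
    (neg_one_lt_zero.trans_le (Nat.cast_nonneg a))]
  simp

lemma gaussMoment_pos (a : ℕ) : 0 < gaussMoment a := by
  rw [gaussMoment_eq]
  have := Real.Gamma_pos_of_pos (s := ((a : ℝ) + 1) / 2) (by positivity)
  positivity

lemma gaussMoment_add_two (a : ℕ) : 2 * gaussMoment (a + 2) = (a + 1) * gaussMoment a := by
  have h := Real.Gamma_add_one (s := ((a : ℝ) + 1) / 2) (by positivity)
  rw [gaussMoment_eq, gaussMoment_eq, show (((a + 2 : ℕ) : ℝ) + 1) / 2 = ((a : ℝ) + 1) / 2 + 1 by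
    push_cast; ring, h]
  ring

lemma integrableOn_pow_mul_exp_neg_sq (a : ℕ) :
    IntegrableOn (fun r : ℝ => r ^ a * Real.exp (-r ^ 2)) (Ioi 0) := by
  simpa using integrableOn_rpow_mul_exp_neg_rpow (p := 2) (s := a)
    (neg_one_lt_zero.trans_le (Nat.cast_nonneg a)) two_pos

/-- The integral over the unit sphere, at height `t = 1`. -/
def sphereIntegral (d : ℕ) (p : AmbientPoly d) : ℝ :=
  ∫ ξ : sphere (0 : EuclideanSpace ℝ (Fin d)) 1, polyEval (ξ : EuclideanSpace ℝ (Fin d)) 1 p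
    ∂(volume : Measure (EuclideanSpace ℝ (Fin d))).toSphere

lemma continuous_polyEval {T : Type*} [TopologicalSpace T] {x : T → EuclideanSpace ℝ (Fin d)}
    {t : T → ℝ} (hx : Continuous x) (ht : Continuous t) (p : AmbientPoly d) :
    Continuous (fun r => polyEval (x r) (t r) p) := by
  induction p using MvPolynomial.induction_on with
  | C a => simpa using continuous_const
  | add p q hp hq => simpa using hp.fun_add hq
  | mul_X p o hp =>
    simp only [map_mul]
    refine hp.mul ?_
    cases o with
    | none => simpa using ht
    | some i => simp only [polyEval_X_some]; fun_prop

lemma integrable_sphere (p : AmbientPoly d) :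
    Integrable (fun ξ : sphere (0 : EuclideanSpace ℝ (Fin d)) 1 =>
      polyEval (ξ : EuclideanSpace ℝ (Fin d)) 1 p)
      (volume : Measure (EuclideanSpace ℝ (Fin d))).toSphere :=
  (continuous_polyEval continuous_subtype_val continuous_const p).integrable_of_hasCompactSupport
    (HasCompactSupport.of_compactSpace _)

lemma sphereIntegral_add (p q : AmbientPoly d) :
    sphereIntegral d (p + q) = sphereIntegral d p + sphereIntegral d q := by
  simp only [sphereIntegral, map_add]
  exact integral_add (integrable_sphere p) (integrable_sphere q)

lemma sphereIntegral_smul (c : ℝ) (p : AmbientPoly d) :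
    sphereIntegral d (c • p) = c * sphereIntegral d p := by
  simp only [sphereIntegral, map_smul, smul_eq_mul]
  exact integral_const_mul _ _

/-- The integral over the unit sphere as a linear functional. -/
def sphereFunctional (d : ℕ) : AmbientPoly d →ₗ[ℝ] ℝ where
  toFun := sphereIntegral d
  map_add' := sphereIntegral_add
  map_smul' := sphereIntegral_smul

lemma xDegree_add (m m' : Option (Fin d) →₀ ℕ) : xDegree (m + m') = xDegree m + xDegree m' := by
  simp [xDegree, Finset.sum_add_distrib]

lemma xDegree_single (i : Fin d) : xDegree (Finsupp.single (some i) 1) = 1 := by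
  classical
  simp [xDegree, Finsupp.single_apply]

section Polar

variable (m : Option (Fin d) →₀ ℕ) (a : ℝ)

lemma integrable_polar :
    Integrable (fun z : sphere (0 : EuclideanSpace ℝ (Fin d)) 1 × Ioi (0 : ℝ) =>
      polyEval (z.1 : EuclideanSpace ℝ (Fin d)) 1 (monomial m a)
        * ((z.2 : ℝ) ^ xDegree m * Real.exp (-(z.2 : ℝ) ^ 2)))
      ((volume : Measure (EuclideanSpace ℝ (Fin d))).toSphere.prod
        (Measure.volumeIoiPow (d - 1))) := by
  refine (integrable_sphere _).mul_prod (g := fun r : Ioi (0 : ℝ) =>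
    (r : ℝ) ^ xDegree m * Real.exp (-(r : ℝ) ^ 2)) ?_
  rw [Measure.volumeIoiPow, integrable_withDensity_iff_integrable_smul' (by fun_prop) (by simp)]
  have h := (integrableOn_iff_comap_subtypeVal measurableSet_Ioi).1
    (integrableOn_pow_mul_exp_neg_sq (d - 1 + xDegree m))
  refine h.congr (Filter.Eventually.of_forall fun r => ?_)
  have hr : (0 : ℝ) < r := r.2
  simp only [Function.comp_apply, smul_eq_mul]
  rw [ENNReal.toReal_ofReal (by positivity)]
  ring

lemma gaussian_polar_apply (x : ({(0 : EuclideanSpace ℝ (Fin d))}ᶜ : Set _)) :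
    polyEval ((homeomorphUnitSphereProd (EuclideanSpace ℝ (Fin d)) x).1 :
        EuclideanSpace ℝ (Fin d)) 1 (monomial m a)
      * (((homeomorphUnitSphereProd (EuclideanSpace ℝ (Fin d)) x).2 : ℝ) ^ xDegree m
        * Real.exp (-((homeomorphUnitSphereProd (EuclideanSpace ℝ (Fin d)) x).2 : ℝ) ^ 2)) =
    polyEval (x : EuclideanSpace ℝ (Fin d)) 1 (monomial m a) *
      Real.exp (-‖(x : EuclideanSpace ℝ (Fin d))‖ ^ 2) := by
  have hx : ‖(x : EuclideanSpace ℝ (Fin d))‖ ≠ 0 := norm_ne_zero_iff.2 x.2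
  rw [homeomorphUnitSphereProd_apply_fst_coe, homeomorphUnitSphereProd_apply_snd_coe,
    polyEval_smul_monomial, inv_pow]
  field_simp

variable [NeZero d]

lemma integrable_gaussian_monomial :
    Integrable (fun x : EuclideanSpace ℝ (Fin d) =>
      polyEval x 1 (monomial m a) * Real.exp (-‖x‖ ^ 2)) := by
  have h := ((volume : Measure (EuclideanSpace ℝ (Fin d))
    ).measurePreserving_homeomorphUnitSphereProd.integrable_comp_emb
      (Homeomorph.measurableEmbedding _)).2 (by simpa using integrable_polar m a)
  rw [← restrict_compl_singleton (μ := volume) (0 : EuclideanSpace ℝ (Fin d)),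
    ← IntegrableOn, integrableOn_iff_comap_subtypeVal (measurableSet_singleton _).compl]
  exact h.congr (Filter.Eventually.of_forall fun x => gaussian_polar_apply m a x)

/-- Polar coordinates: the Gaussian is radial and the monomial is homogeneous in `x`, so the
integral factors. This turns identities over `ℝ^d` into identities over the sphere. -/
lemma integral_gaussian_monomial :
    ∫ x : EuclideanSpace ℝ (Fin d), polyEval x 1 (monomial m a) * Real.exp (-‖x‖ ^ 2) =
      sphereIntegral d (monomial m a) * gaussMoment (d - 1 + xDegree m) := by
  have h := (volume : Measure (EuclideanSpace ℝ (Fin d))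
    ).measurePreserving_homeomorphUnitSphereProd.integral_comp
      (Homeomorph.measurableEmbedding _) (fun z =>
      polyEval (z.1 : EuclideanSpace ℝ (Fin d)) 1 (monomial m a)
        * ((z.2 : ℝ) ^ xDegree m * Real.exp (-(z.2 : ℝ) ^ 2)))
  simp only [gaussian_polar_apply] at h
  rw [integral_subtype_comap (measurableSet_singleton _).compl (fun x : EuclideanSpace ℝ (Fin d) =>
    polyEval x 1 (monomial m a) * Real.exp (-‖x‖ ^ 2)), restrict_compl_singleton] at h
  rw [h, integral_prod_mul (fun ξ : sphere (0 : EuclideanSpace ℝ (Fin d)) 1 =>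
    polyEval (ξ : EuclideanSpace ℝ (Fin d)) 1 (monomial m a)) (fun r : Ioi (0 : ℝ) =>
    (r : ℝ) ^ xDegree m * Real.exp (-(r : ℝ) ^ 2)), sphereIntegral]
  congr 1
  rw [Measure.volumeIoiPow, integral_withDensity_eq_integral_toReal_smul (by fun_prop) (by simp),
    gaussMoment, ← integral_subtype_comap measurableSet_Ioi]
  refine integral_congr_ae (Filter.Eventually.of_forall fun r => ?_)
  have hr : (0 : ℝ) < r := r.2
  simp only [smul_eq_mul]
  rw [ENNReal.toReal_ofReal (by positivity), finrank_euclideanSpace_fin]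
  ring

/-- Integration by parts against `e^{-‖x‖²}`, whose `i`-th derivative is `-2 x_i e^{-‖x‖²}`; the
decay leaves no boundary term. -/
lemma integral_gaussian_pderiv (i : Fin d) :
    ∫ x : EuclideanSpace ℝ (Fin d),
        polyEval x 1 (pderiv (some i) (monomial m a)) * Real.exp (-‖x‖ ^ 2) =
      2 * ∫ x : EuclideanSpace ℝ (Fin d),
        polyEval x 1 (X (some i) * monomial m a) * Real.exp (-‖x‖ ^ 2) := by
  classical
  have hX : X (some i) * monomial m a = monomial (m + Finsupp.single (some i) 1) a := by
    rw [X, monomial_mul, one_mul, add_comm]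
  have hI := integrable_gaussian_monomial (m + Finsupp.single (some i) 1) a
  have key := integral_bilinear_hasLineDerivAt_right_eq_neg_left_of_integrable
    (μ := (volume : Measure (EuclideanSpace ℝ (Fin d))))
    (f := fun x => polyEval x 1 (monomial m a))
    (f' := fun x => polyEval x 1 (pderiv (some i) (monomial m a)))
    (g := fun x => Real.exp (-‖x‖ ^ 2)) (g' := fun x => -2 * x i * Real.exp (-‖x‖ ^ 2))
    (v := EuclideanSpace.single i (1 : ℝ)) (B := ContinuousLinearMap.mul ℝ ℝ)
    (by rw [pderiv_monomial]; exact integrable_gaussian_monomial _ _)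
    (by
      refine (hI.const_mul (-2)).congr (Filter.Eventually.of_forall fun x => ?_)
      rw [← hX]
      simp
      ring)
    (integrable_gaussian_monomial m a)
    (fun x _ => by
      refine (hasDerivAt_polyEval (x := fun s : ℝ => x + s • EuclideanSpace.single i (1 : ℝ))
        (x' := fun j => if j = i then 1 else 0) (t := fun _ => 1) (t' := 0) (fun j => ?_)
        (hasDerivAt_const _ _) _).congr_deriv (by simp)
      have := ((hasDerivAt_id (0 : ℝ)).mul_const (if j = i then (1 : ℝ) else 0)).const_add (x j)
      simpa [PiLp.single_apply] using this)
    (fun x _ => by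
      have h1 : HasDerivAt (fun s : ℝ => -‖x + s • EuclideanSpace.single i (1 : ℝ)‖ ^ 2)
          (-(2 * x i)) 0 := by
        have := ((((hasDerivAt_id (0 : ℝ)).const_mul (2 * x i)).const_add (‖x‖ ^ 2)).add
          ((hasDerivAt_id (0 : ℝ)).pow 2)).neg
        refine (this.congr_deriv (by simp)).congr_of_eventuallyEq
          (Filter.Eventually.of_forall fun s => ?_)
        simp only [Pi.neg_apply, Pi.add_apply]
        rw [norm_add_sq_real, norm_smul, inner_smul_right, EuclideanSpace.inner_single_right]
        simp
        ring
      refine h1.exp.congr_deriv ?_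
      simp
      ring)
  simp only [ContinuousLinearMap.mul_apply'] at key
  rw [eq_comm, ← neg_inj, ← key, ← integral_const_mul, ← integral_neg]
  refine integral_congr_ae (Filter.Eventually.of_forall fun x => ?_)
  simp
  ring

end Polar

/-- The divergence theorem for polynomials on the sphere. -/
lemma sphereFunctional_pderiv [NeZero d] (i : Fin d) (p : AmbientPoly d) :
    sphereFunctional d (pderiv (some i) p) =
      sphereFunctional d (X (some i) * (eulerX d p + ((d : ℝ) - 1) • p)) := by
  classical
  induction p using MvPolynomial.induction_on' with
  | add p q hp hq =>
    simp only [map_add, hp, hq, smul_add, mul_add]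
    ring
  | monomial m a =>
    have hX : X (some i) * monomial m a = monomial (m + Finsupp.single (some i) 1) a := by
      rw [X, monomial_mul, one_mul, add_comm]
    have h := integral_gaussian_pderiv m a i
    rw [hX, integral_gaussian_monomial, pderiv_monomial, integral_gaussian_monomial,
      xDegree_add, xDegree_single] at h
    have hd : ((d - 1 : ℕ) : ℝ) = d - 1 := by
      rw [Nat.cast_sub (Nat.one_le_iff_ne_zero.2 (NeZero.ne d)), Nat.cast_one]
    rw [eulerX_monomial, ← add_smul, mul_smul_comm, hX, pderiv_monomial, map_smul, smul_eq_mul]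
    change sphereIntegral d _ = _ * sphereIntegral d _
    -- If `x_i` does not occur, the exponent `m - single i` is truncated and its degree is not one
    -- less. The derivative is then zero, and the positive moment forces the other sphere integral
    -- to vanish too.
    rcases Nat.eq_zero_or_pos (m (some i)) with hm | hm
    · have h0 : sphereIntegral d (monomial (m - Finsupp.single (some i) 1) (a * (m (some i) : ℝ)))
          = 0 := by
        simp [hm, sphereIntegral]
      rw [h0, zero_mul, eq_comm, mul_eq_zero, mul_eq_zero] at h
      have := (gaussMoment_pos (d - 1 + (xDegree m + 1))).ne'
      rw [h0]
      rcases h with h | h | h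
      · norm_num at h
      · rw [h, mul_zero]
      · exact absurd h this
    · have hle : Finsupp.single (some i) 1 ≤ m := by
        rwa [Finsupp.single_le_iff]
      have hk : xDegree m = xDegree (m - Finsupp.single (some i) 1) + 1 := by
        conv_lhs => rw [← tsub_add_cancel_of_le hle, xDegree_add, xDegree_single]
      rw [hk] at h ⊢
      set k := xDegree (m - Finsupp.single (some i) 1)
      -- With `k + 1` the degree in `x`, the two Gaussian moments differ by the factor `(d + k) /
      -- 2`, which produces the coefficient `k + 1 + (d - 1)` of the claim.
      have hg := gaussMoment_add_two (d - 1 + k)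
      have hpos := (gaussMoment_pos (d - 1 + k)).ne'
      rw [show d - 1 + (k + 1 + 1) = d - 1 + k + 2 by ring] at h
      rw [← mul_left_inj' hpos, h]
      push_cast [hd] at hg ⊢
      linear_combination sphereIntegral d (monomial (m + Finsupp.single (some i) 1) a) * hg

/-- Green's formula: the Laplace–Beltrami operator of the sphere is symmetric. -/
theorem sphereFunctional_spherePart_mul [NeZero d] (f g : AmbientPoly d) :
    sphereFunctional d (spherePart d f * g) = sphereFunctional d (f * spherePart d g) := by
  have hdiv : laplacianX d f * g - f * laplacianX d g =
      ∑ i : Fin d, pderiv (some i) (g * pderiv (some i) f - f * pderiv (some i) g) := by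
    rw [laplacianX_apply, laplacianX_apply, Finset.sum_mul, Finset.mul_sum,
      ← Finset.sum_sub_distrib]
    refine Finset.sum_congr rfl fun i _ => ?_
    simp only [map_sub, Derivation.leibniz, smul_eq_mul]
    ring
  -- The divergence theorem is applied to the field `g ∇f - f ∇g`. Moving `x_i` inside `E_x` costs
  -- one copy of the field because `E_x x_i = x_i`, hence `d - 2` in place of `d - 1`.
  have hrad : ∑ i : Fin d, X (some i) * (eulerX d (g * pderiv (some i) f - f * pderiv (some i) g)
        + ((d : ℝ) - 1) • (g * pderiv (some i) f - f * pderiv (some i) g)) =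
      eulerX d (g * eulerX d f - f * eulerX d g)
        + ((d : ℝ) - 2) • (g * eulerX d f - f * eulerX d g) := by
    have h1 : g * eulerX d f - f * eulerX d g =
        ∑ i : Fin d, X (some i) * (g * pderiv (some i) f - f * pderiv (some i) g) := by
      rw [eulerX_apply, eulerX_apply, Finset.mul_sum, Finset.mul_sum, ← Finset.sum_sub_distrib]
      exact Finset.sum_congr rfl fun i _ => by ring
    rw [h1, map_sum, Finset.smul_sum, ← Finset.sum_add_distrib]
    refine Finset.sum_congr rfl fun i _ => ?_
    rw [Derivation.leibniz (eulerX d) (X (some i)), eulerX_X_some]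
    simp only [smul_eq_C_mul, map_sub, map_one, map_ofNat, smul_eq_mul]
    ring
  have h := congrArg (sphereFunctional d) hdiv
  rw [map_sum, Finset.sum_congr rfl fun i _ => sphereFunctional_pderiv i _, ← map_sum, hrad] at h
  rw [← sub_eq_zero, ← map_sub]
  have h2 : spherePart d f * g - f * spherePart d g =
      (laplacianX d f * g - f * laplacianX d g) - (eulerX d (g * eulerX d f - f * eulerX d g)
        + ((d : ℝ) - 2) • (g * eulerX d f - f * eulerX d g)) := by
    simp only [spherePart_apply, map_sub, Derivation.leibniz, smul_eq_C_mul, smul_eq_mul]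
    ring
  rw [h2, map_sub, h, sub_self]

/-! ### Beta integrals and the radial moments. -/

section Beta

variable {a b : ℝ}

lemma ofReal_beta_integrand {x : ℝ} (hx : x ∈ Ioo (0 : ℝ) 1) :
    ((x : ℂ) ^ ((a : ℂ) - 1) * (1 - (x : ℂ)) ^ ((b : ℂ) - 1)) =
      ((x ^ (a - 1) * (1 - x) ^ (b - 1) : ℝ) : ℂ) := by
  push_cast
  rw [Complex.ofReal_cpow hx.1.le, Complex.ofReal_cpow (sub_nonneg.2 hx.2.le)]
  push_cast
  rfl

lemma integrableOn_beta (ha : 0 < a) (hb : 0 < b) :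
    IntegrableOn (fun x : ℝ => x ^ (a - 1) * (1 - x) ^ (b - 1)) (Ioo 0 1) := by
  have h := Complex.betaIntegral_convergent (u := a) (v := b) (by simpa) (by simpa)
  rw [intervalIntegrable_iff_integrableOn_Ioo_of_le zero_le_one] at h
  refine IntegrableOn.congr_fun h.re (fun x hx => ?_) measurableSet_Ioo
  simp only [ofReal_beta_integrand hx]
  exact Complex.ofReal_re _

lemma integral_beta (ha : 0 < a) (hb : 0 < b) :
    ∫ x in Ioo (0 : ℝ) 1, x ^ (a - 1) * (1 - x) ^ (b - 1) = ProbabilityTheory.beta a b := by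
  rw [ProbabilityTheory.beta_eq_betaIntegralReal a b ha hb, Complex.betaIntegral,
    intervalIntegral.integral_of_le zero_le_one, integral_Ioc_eq_integral_Ioo,
    setIntegral_congr_fun measurableSet_Ioo fun x hx => ofReal_beta_integrand hx,
    integral_complex_ofReal, Complex.ofReal_re]

lemma beta_add_one (ha : 0 < a) (hb : 0 < b) :
    (a + b) * ProbabilityTheory.beta (a + 1) b = a * ProbabilityTheory.beta a b := by
  have hab := add_pos ha hb
  have h := (Real.Gamma_pos_of_pos hab).ne'
  rw [ProbabilityTheory.beta, ProbabilityTheory.beta, Real.Gamma_add_one ha.ne',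
    show a + 1 + b = a + b + 1 by ring, Real.Gamma_add_one hab.ne']
  field_simp

end Beta

/-- The density in `t` of the weighted surface measure `t⁻¹ (1 - t)^γ dσ`. -/
def radialWeight (d : ℕ) (γ t : ℝ) : ℝ := t ^ (d - 1) * jacobiWeight (-1) γ t

/-- The exponent of `t` is `m + d - 2`, so the Beta parameters are `m + d - 1` and `γ + 1`; they are
positive exactly because `d ≥ 2` and `γ > -1`. -/
lemma radialWeight_eq_rpow (d : ℕ) (hd : 2 ≤ d) (γ : ℝ) {t : ℝ} (ht : t ∈ Ioo (0 : ℝ) 1) (m : ℕ) :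
    t ^ m * radialWeight d γ t = t ^ ((m + d - 1 : ℝ) - 1) * (1 - t) ^ ((γ + 1) - 1) := by
  rw [radialWeight, jacobiWeight, ← mul_assoc, ← mul_assoc, ← Real.rpow_natCast t m,
    ← Real.rpow_natCast t (d - 1), ← Real.rpow_add ht.1, ← Real.rpow_add ht.1,
    Nat.cast_sub (by omega), Nat.cast_one, add_sub_cancel_right]
  ring_nf

lemma integrableOn_pow_mul_radialWeight (hd : 2 ≤ d) {γ : ℝ} (hγ : -1 < γ) (m : ℕ) :
    IntegrableOn (fun t => t ^ m * radialWeight d γ t) (Icc 0 1) := by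
  have hd' : (2 : ℝ) ≤ d := by exact_mod_cast hd
  rw [integrableOn_Icc_iff_integrableOn_Ioo]
  exact (integrableOn_beta (a := m + d - 1) (b := γ + 1) (by linarith [m.cast_nonneg (α := ℝ)])
    (by linarith)).congr_fun (fun t ht => (radialWeight_eq_rpow d hd γ ht m).symm) measurableSet_Ioo

/-- The moments of the radial weight. -/
def radialMoment (d : ℕ) (γ : ℝ) (m : ℕ) : ℝ :=
  ∫ t in Icc (0 : ℝ) 1, t ^ m * radialWeight d γ t

lemma radialMoment_eq (hd : 2 ≤ d) {γ : ℝ} (hγ : -1 < γ) (m : ℕ) :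
    radialMoment d γ m = ProbabilityTheory.beta (m + d - 1) (γ + 1) := by
  have hd' : (2 : ℝ) ≤ d := by exact_mod_cast hd
  rw [radialMoment, integral_Icc_eq_integral_Ioo,
    setIntegral_congr_fun measurableSet_Ioo fun t ht => radialWeight_eq_rpow d hd γ ht m,
    integral_beta (by linarith [m.cast_nonneg (α := ℝ)]) (by linarith)]

lemma radialMoment_succ (hd : 2 ≤ d) {γ : ℝ} (hγ : -1 < γ) (m : ℕ) :
    (m + d + γ) * radialMoment d γ (m + 1) = (m + d - 1) * radialMoment d γ m := by
  have hd' : (2 : ℝ) ≤ d := by exact_mod_cast hd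
  rw [radialMoment_eq hd hγ, radialMoment_eq hd hγ, ← beta_add_one
    (by linarith [m.cast_nonneg (α := ℝ)]) (by linarith)]
  push_cast
  ring_nf

lemma radialMoment_zero_pos (hd : 2 ≤ d) {γ : ℝ} (hγ : -1 < γ) : 0 < radialMoment d γ 0 := by
  have hd' : (2 : ℝ) ≤ d := by exact_mod_cast hd
  rw [radialMoment_eq hd hγ]
  exact ProbabilityTheory.beta_pos (by push_cast; linarith) (by linarith)

/-! ### The cone integral as a radial integral of sphere integrals. -/

/-- The integral of a polynomial over the cone against `t⁻¹ (1 - t)^γ dσ`. -/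
def coneIntegral (d : ℕ) (γ : ℝ) (p : AmbientPoly d) : ℝ :=
  ∫ q : coneSurface d, polyEval q.1.1 q.1.2 p * jacobiWeight (-1) γ q.1.2 ∂(coneMeasure d)

lemma coneInner_mk (γ : ℝ) (f g : AmbientPoly d) :
    coneInner d (-1) γ (Ideal.Quotient.mk (coneIdeal d) f) (Ideal.Quotient.mk (coneIdeal d) g) =
      normConst d (-1) γ * coneIntegral d γ (f * g) := by
  simp only [coneInner, restrictSurface, evalAt_mk, coneIntegral, map_mul]

lemma normConst_eq (γ : ℝ) : normConst d (-1) γ = (coneIntegral d γ 1)⁻¹ := by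
  simp [normConst, coneIntegral]

@[fun_prop]
lemma measurable_jacobiWeight (β γ : ℝ) : Measurable (jacobiWeight β γ) := by
  unfold jacobiWeight
  fun_prop

lemma continuous_coneParam : Continuous (coneParam d) := by
  unfold coneParam
  fun_prop

/-- The measure `t^{d-1} dt` on `[0, 1]`. -/
abbrev radialMeasure (d : ℕ) : Measure (Icc (0 : ℝ) 1) :=
  (volume : Measure (Icc (0 : ℝ) 1)).withDensity (fun t => ENNReal.ofReal ((t : ℝ) ^ (d - 1)))

lemma integrable_cone_param (hd : 2 ≤ d) {γ : ℝ} (hγ : -1 < γ) (p : AmbientPoly d) :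
    Integrable (fun z : Icc (0 : ℝ) 1 × sphere (0 : EuclideanSpace ℝ (Fin d)) 1 =>
      polyEval ((z.1 : ℝ) • (z.2 : EuclideanSpace ℝ (Fin d))) z.1 p * jacobiWeight (-1) γ z.1)
      ((radialMeasure d).prod (volume : Measure (EuclideanSpace ℝ (Fin d))).toSphere) := by
  have hw : Integrable (fun t : Icc (0 : ℝ) 1 => jacobiWeight (-1) γ t) (radialMeasure d) := by
    rw [integrable_withDensity_iff_integrable_smul' (by fun_prop) (by simp)]
    have h := (integrableOn_iff_comap_subtypeVal measurableSet_Icc).1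
      (integrableOn_pow_mul_radialWeight hd hγ 0)
    refine h.congr (Filter.Eventually.of_forall fun t => ?_)
    have ht : (0 : ℝ) ≤ t := t.2.1
    simp only [Function.comp_apply, smul_eq_mul, radialWeight]
    rw [ENNReal.toReal_ofReal (by positivity), pow_zero, one_mul]
  have hcont : Continuous (fun z : Icc (0 : ℝ) 1 × sphere (0 : EuclideanSpace ℝ (Fin d)) 1 =>
      polyEval ((z.1 : ℝ) • (z.2 : EuclideanSpace ℝ (Fin d))) z.1 p) :=
    continuous_polyEval (by fun_prop) (by fun_prop) p
  -- The polynomial factor is bounded on the compact product, so integrability of the weight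
  -- suffices.
  obtain ⟨C, hC⟩ := (isCompact_range hcont).isBounded.exists_norm_le
  refine (hw.comp_fst _).bdd_mul (c := C) hcont.aestronglyMeasurable
    (Filter.Eventually.of_forall fun z => hC _ (mem_range_self z))

lemma coneIntegral_eq_integral_prod (γ : ℝ) (p : AmbientPoly d) :
    coneIntegral d γ p = ∫ z : Icc (0 : ℝ) 1 × sphere (0 : EuclideanSpace ℝ (Fin d)) 1,
      polyEval ((z.1 : ℝ) • (z.2 : EuclideanSpace ℝ (Fin d))) z.1 p * jacobiWeight (-1) γ z.1
      ∂((radialMeasure d).prod (volume : Measure (EuclideanSpace ℝ (Fin d))).toSphere) := by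
  rw [coneIntegral, coneMeasure, integral_map continuous_coneParam.aemeasurable]
  · rfl
  · refine AEStronglyMeasurable.mul ?_ ?_
    · exact (continuous_polyEval (by fun_prop) (by fun_prop) p).aestronglyMeasurable
    · exact Measurable.aestronglyMeasurable (by fun_prop)

/-- The integral of a polynomial over the unit sphere scaled to height `t`. -/
def sliceIntegral (d : ℕ) (p : AmbientPoly d) (t : ℝ) : ℝ :=
  ∫ ξ : sphere (0 : EuclideanSpace ℝ (Fin d)) 1,
    polyEval (t • (ξ : EuclideanSpace ℝ (Fin d))) t p
    ∂(volume : Measure (EuclideanSpace ℝ (Fin d))).toSphere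

lemma coneIntegral_eq (hd : 2 ≤ d) {γ : ℝ} (hγ : -1 < γ) (p : AmbientPoly d) :
    coneIntegral d γ p =
      ∫ t in Icc (0 : ℝ) 1, sliceIntegral d p t * radialWeight d γ t := by
  rw [coneIntegral_eq_integral_prod, integral_prod _ (integrable_cone_param hd hγ p),
    integral_withDensity_eq_integral_toReal_smul (by fun_prop) (by simp),
    ← integral_subtype measurableSet_Icc]
  refine integral_congr_ae (Filter.Eventually.of_forall fun t => ?_)
  have ht : (0 : ℝ) ≤ t := t.2.1
  simp only [smul_eq_mul]
  rw [ENNReal.toReal_ofReal (by positivity), integral_mul_const, sliceIntegral, radialWeight]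
  ring

/-- The integral over the cone as a linear functional. -/
def coneFunctional (hd : 2 ≤ d) {γ : ℝ} (hγ : -1 < γ) : AmbientPoly d →ₗ[ℝ] ℝ where
  toFun := coneIntegral d γ
  map_add' p q := by
    simp only [coneIntegral_eq_integral_prod, map_add, add_mul]
    exact integral_add (integrable_cone_param hd hγ p) (integrable_cone_param hd hγ q)
  map_smul' c p := by
    simp only [coneIntegral_eq_integral_prod, map_smul, smul_eq_mul, mul_assoc, RingHom.id_apply]
    exact integral_const_mul _ _

lemma polyEval_smul_of_isHomogeneous {p : AmbientPoly d} {m : ℕ} (hp : p.IsHomogeneous m)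
    (x : EuclideanSpace ℝ (Fin d)) (t : ℝ) :
    polyEval (t • x) t p = t ^ m * polyEval x 1 p := by
  have h : (fun o : Option (Fin d) => o.elim t (fun i => (t • x) i)) =
      fun o => t * o.elim 1 (fun i => x i) := by
    ext (_ | i) <;> simp
  simp only [polyEval, h]
  simp only [aeval_def, eval₂_eq', Finset.mul_sum, mul_pow, Finset.prod_mul_distrib,
    Finset.prod_pow_eq_pow_sum]
  refine Finset.sum_congr rfl fun s hs => ?_
  have hs' := hp (mem_support_iff.1 hs)
  rw [Finsupp.weight_apply, Finsupp.sum_fintype _ _ (by simp)] at hs'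
  simp only [Pi.one_apply, smul_eq_mul, mul_one] at hs'
  rw [hs']
  ring

lemma coneFunctional_of_isHomogeneous (hd : 2 ≤ d) {γ : ℝ} (hγ : -1 < γ) {p : AmbientPoly d}
    {m : ℕ} (hp : p.IsHomogeneous m) :
    coneFunctional hd hγ p = radialMoment d γ m * sphereFunctional d p := by
  change coneIntegral d γ p = _
  rw [coneIntegral_eq hd hγ, radialMoment, ← integral_mul_const]
  refine integral_congr_ae (Filter.Eventually.of_forall fun t => ?_)
  simp only [sliceIntegral, polyEval_smul_of_isHomogeneous hp, integral_const_mul]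
  change _ = _ * sphereIntegral d p
  rw [sphereIntegral]
  ring

/-! ### Symmetry of the operator. -/

lemma sphereFunctional_congr {p q : AmbientPoly d}
    (h : ∀ x : EuclideanSpace ℝ (Fin d), polyEval x 1 p = polyEval x 1 q) :
    sphereFunctional d p = sphereFunctional d q := by
  change sphereIntegral d p = sphereIntegral d q
  simp only [sphereIntegral, h]

/-- At `t = 1` the identity for `t R` reads `R = spherePart + E² + (d - 2) E`, and `E` acts on `f`
as `m`. -/
lemma sphereFunctional_loweringPart_mul {f : AmbientPoly d} {m : ℕ} (hf : f.IsHomogeneous m)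
    (g : AmbientPoly d) :
    sphereFunctional d (loweringPart d f * g) =
      sphereFunctional d (spherePart d f * g)
        + (m : ℝ) * (m + d - 2) * sphereFunctional d (f * g) := by
  rw [← smul_eq_mul (_ * _) (sphereFunctional d (f * g)), ← map_smul, ← map_add]
  refine sphereFunctional_congr fun x => ?_
  have h := congrArg (polyEval x 1) (X_none_mul_loweringPart f)
  simp only [map_sub, map_add, map_mul, map_smul, smul_eq_mul, map_pow, polyEval_X_none,
    spherePart_apply, euler_of_isHomogeneous hf, Derivation.map_smul] at h ⊢
  linear_combination polyEval x 1 g * h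

lemma coneFunctional_coneOpPoly_mul_of_isHomogeneous (hd : 2 ≤ d) {γ : ℝ} (hγ : -1 < γ)
    {f g : AmbientPoly d} {m m' N : ℕ} (hf : f.IsHomogeneous m) (hg : g.IsHomogeneous m')
    (hN : m + m' = N + 1) :
    coneFunctional hd hγ (coneOpPoly d γ f * g) =
      radialMoment d γ N * (sphereFunctional d (spherePart d f * g)
        + (m : ℝ) * (m + d - 2) * sphereFunctional d (f * g))
        - (m : ℝ) * (m + γ + d - 1) * (radialMoment d γ (N + 1) * sphereFunctional d (f * g)) := by
  have hR : (loweringPart d f * g).IsHomogeneous N := by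
    rcases m with _ | m
    · rw [loweringPart_of_isHomogeneous_zero hf, zero_mul]
      exact isHomogeneous_zero _ _ _
    · convert (isHomogeneous_loweringPart hf).mul hg using 1
      omega
  have hfg : (f * g).IsHomogeneous (N + 1) := hN ▸ hf.mul hg
  rw [coneOpPoly_of_isHomogeneous γ hf, sub_mul, smul_mul_assoc, map_sub, map_smul, smul_eq_mul,
    coneFunctional_of_isHomogeneous hd hγ hR, coneFunctional_of_isHomogeneous hd hγ hfg,
    sphereFunctional_loweringPart_mul hf]

lemma coneOpPoly_of_isHomogeneous_zero (γ : ℝ) {f : AmbientPoly d} (hf : f.IsHomogeneous 0) :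
    coneOpPoly d γ f = 0 := by
  rw [coneOpPoly_of_isHomogeneous γ hf, loweringPart_of_isHomogeneous_zero hf]
  simp

/-- The operator `D_{-1,γ}` is symmetric. -/
theorem coneFunctional_coneOpPoly_mul (hd : 2 ≤ d) {γ : ℝ} (hγ : -1 < γ) (f g : AmbientPoly d) :
    coneFunctional hd hγ (coneOpPoly d γ f * g) = coneFunctional hd hγ (f * coneOpPoly d γ g) := by
  have : NeZero d := ⟨by omega⟩
  have hhom {m m' : ℕ} {f g : AmbientPoly d} (hf : f.IsHomogeneous m) (hg : g.IsHomogeneous m') :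
      coneFunctional hd hγ (coneOpPoly d γ f * g) =
        coneFunctional hd hγ (f * coneOpPoly d γ g) := by
    -- The lowering term has degree `m + m' - 1`, so two constants are treated apart; the operator
    -- kills them.
    rcases Nat.eq_zero_or_eq_succ_pred (m + m') with h0 | hN
    · obtain ⟨rfl, rfl⟩ : m = 0 ∧ m' = 0 := by omega
      rw [coneOpPoly_of_isHomogeneous_zero γ hf, coneOpPoly_of_isHomogeneous_zero γ hg, zero_mul,
        mul_zero]
    · set N := (m + m').pred
      have hG := sphereFunctional_spherePart_mul f g
      have hB := radialMoment_succ hd hγ N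
      have hNr : (N : ℝ) = m + m' - 1 := by
        rw [eq_sub_iff_add_eq]
        exact_mod_cast hN.symm
      rw [hNr] at hB
      rw [mul_comm f (coneOpPoly d γ g),
        coneFunctional_coneOpPoly_mul_of_isHomogeneous hd hγ hf hg hN,
        coneFunctional_coneOpPoly_mul_of_isHomogeneous hd hγ hg hf ((add_comm _ _).trans hN),
        mul_comm g f, mul_comm (spherePart d g) f, hG]
      -- By Green's formula the spherical terms cancel. The rest is `(m - m')` times `(m + m' + d -
      -- 2) B_N - (m + m' + γ + d - 1) B_{N+1}`, with `B` the radial moments and `N = m + m' - 1`: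
      -- the moment recurrence.
      linear_combination (-(m - m' : ℝ) * sphereFunctional d (f * g)) * hB
  induction f using MvPolynomial.induction_on' with
  | add p q hp hq => simp only [map_add, add_mul, hp, hq]
  | monomial s a =>
    induction g using MvPolynomial.induction_on' with
    | add p q hp hq => simp only [map_add, mul_add, hp, hq]
    | monomial s' a' => exact hhom (isHomogeneous_monomial a rfl) (isHomogeneous_monomial a' rfl)

/-! ### Definiteness of the inner product and the eigenvalue equation. -/

lemma normConst_ne_zero (hd : 2 ≤ d) {γ : ℝ} (hγ : -1 < γ) : normConst d (-1) γ ≠ 0 := by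
  have : NeZero d := ⟨by omega⟩
  have h := coneFunctional_of_isHomogeneous hd hγ (isHomogeneous_one (Option (Fin d)) ℝ)
  have hS : sphereFunctional d 1 =
      (volume : Measure (EuclideanSpace ℝ (Fin d))).toSphere.real univ := by
    change sphereIntegral d 1 = _
    simp only [sphereIntegral, map_one]
    rw [integral_const, smul_eq_mul, mul_one]
  have hpos : 0 < (volume : Measure (EuclideanSpace ℝ (Fin d))).toSphere.real univ := by
    rw [measureReal_def, ENNReal.toReal_pos_iff]
    exact ⟨Measure.measure_univ_pos.2 (Measure.toSphere_ne_zero _), measure_lt_top _ _⟩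
  rw [normConst_eq]
  refine inv_ne_zero ?_
  change coneFunctional hd hγ 1 ≠ 0
  rw [h, hS]
  exact (mul_pos (radialMoment_zero_pos hd hγ) hpos).ne'

lemma continuous_sliceIntegral (p : AmbientPoly d) : Continuous (sliceIntegral d p) := by
  have h := continuous_parametric_integral_of_continuous
    (μ := (volume : Measure (EuclideanSpace ℝ (Fin d))).toSphere)
    (f := fun (t : ℝ) (ξ : sphere (0 : EuclideanSpace ℝ (Fin d)) 1) =>
      polyEval (t • (ξ : EuclideanSpace ℝ (Fin d))) t p)
    (continuous_polyEval (by fun_prop) (by fun_prop) p) isCompact_univ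
  simp only [Measure.restrict_univ] at h
  exact h

lemma radialWeight_pos (d : ℕ) (γ : ℝ) {t : ℝ} (ht : t ∈ Ioo (0 : ℝ) 1) :
    0 < radialWeight d γ t :=
  mul_pos (pow_pos ht.1 _)
    (mul_pos (Real.rpow_pos_of_pos ht.1 _) (Real.rpow_pos_of_pos (sub_pos.2 ht.2) _))

lemma sliceIntegral_mul_self_nonneg (w : AmbientPoly d) (t : ℝ) :
    0 ≤ sliceIntegral d (w * w) t :=
  integral_nonneg fun ξ => by
    rw [map_mul]
    exact mul_self_nonneg _

/-- The inner product is definite: a polynomial of norm zero vanishes on the cone. -/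
theorem polyEval_eq_zero_of_coneIntegral_mul_self (hd : 2 ≤ d) {γ : ℝ} (hγ : -1 < γ)
    {w : AmbientPoly d} (hw : coneIntegral d γ (w * w) = 0)
    (ξ : sphere (0 : EuclideanSpace ℝ (Fin d)) 1) {t : ℝ} (ht : t ∈ Icc (0 : ℝ) 1) :
    polyEval (t • (ξ : EuclideanSpace ℝ (Fin d))) t w = 0 := by
  have hρ := integrableOn_pow_mul_radialWeight hd hγ 0
  simp only [pow_zero, one_mul] at hρ
  have hint : IntegrableOn (fun t => sliceIntegral d (w * w) t * radialWeight d γ t) (Icc 0 1) :=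
    hρ.continuousOn_mul (continuous_sliceIntegral _).continuousOn isCompact_Icc
  rw [coneIntegral_eq hd hγ, integral_Icc_eq_integral_Ioo,
    setIntegral_eq_zero_iff_of_nonneg_ae ?_ (hint.mono_set Ioo_subset_Icc_self)] at hw
  swap
  · filter_upwards [ae_restrict_mem measurableSet_Ioo] with s hs
    exact mul_nonneg (sliceIntegral_mul_self_nonneg w s) (radialWeight_pos d γ hs).le
  have hae : sliceIntegral d (w * w) =ᵐ[volume.restrict (Ioo (0 : ℝ) 1)] fun _ => 0 := by
    filter_upwards [hw, ae_restrict_mem measurableSet_Ioo] with s hs hs'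
    exact (mul_eq_zero.1 hs).resolve_right (radialWeight_pos d γ hs').ne'
  -- Continuity upgrades almost everywhere to everywhere, once in `t` and once on the sphere. The
  -- open interval is needed because the weight is positive only there; the endpoints are recovered
  -- by closure.
  have hslice := Measure.eqOn_open_of_ae_eq hae isOpen_Ioo
    (continuous_sliceIntegral _).continuousOn continuousOn_const
  have hopen : EqOn (fun s => polyEval (s • (ξ : EuclideanSpace ℝ (Fin d))) s w) (fun _ => 0)
      (Ioo 0 1) := by
    intro s hs
    have h := hslice hs
    have hcont : Continuous fun η : sphere (0 : EuclideanSpace ℝ (Fin d)) 1 =>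
        polyEval (s • (η : EuclideanSpace ℝ (Fin d))) s (w * w) :=
      continuous_polyEval (by fun_prop) (by fun_prop) _
    rw [sliceIntegral, integral_eq_zero_iff_of_nonneg
      (fun η => by rw [map_mul]; exact mul_self_nonneg _)
      (hcont.integrable_of_hasCompactSupport (HasCompactSupport.of_compactSpace _))] at h
    have h' := congrFun ((hcont.ae_eq_iff_eq _ continuous_zero).1 h) ξ
    simpa using h'
  have hclosure := hopen.closure
    (continuous_polyEval (by fun_prop) (by fun_prop) w) continuous_const
  rw [closure_Ioo zero_ne_one] at hclosure
  exact hclosure ht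

lemma mk_mem_polyDegreeLE {n : ℕ} {p : AmbientPoly d}
    (hp : p ∈ restrictTotalDegree (Option (Fin d)) ℝ n) :
    Ideal.Quotient.mk (coneIdeal d) p ∈ polyDegreeLE d n :=
  Submodule.mem_map_of_mem (f := (Ideal.Quotient.mkₐ ℝ (coneIdeal d)).toLinearMap) hp

/-- On a representative `p` of an orthogonal polynomial of degree `n`, the eigenvalue equation
holds at every point of the cone. -/
theorem polyEval_coneOpPoly_add_smul (hd : 2 ≤ d) {γ : ℝ} (hγ : -1 < γ) {n : ℕ}
    {p : AmbientPoly d} (hp : p ∈ restrictTotalDegree (Option (Fin d)) ℝ n)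
    (horth : Ideal.Quotient.mk (coneIdeal d) p ∈ orthogonalPolys d (-1) γ n)
    (ξ : sphere (0 : EuclideanSpace ℝ (Fin d)) 1) {t : ℝ} (ht : t ∈ Icc (0 : ℝ) 1) :
    polyEval (t • (ξ : EuclideanSpace ℝ (Fin d))) t
      (coneOpPoly d γ p + ((n : ℝ) * (n + γ + d - 1)) • p) = 0 := by
  -- For `n = 0` orthogonality is an empty condition; the equation holds because constants are
  -- killed.
  rcases n with _ | n
  · rw [mem_restrictTotalDegree, Nat.le_zero, totalDegree_zero_iff_isHomogeneous] at hp
    rw [coneOpPoly_of_isHomogeneous_zero γ hp]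
    simp
  · have hw := coneOpPoly_add_smul_mem γ hp
    set w := coneOpPoly d γ p + (((n + 1 : ℕ) : ℝ) * ((n + 1 : ℕ) + γ + d - 1)) • p with hwdef
    have hzero {q : AmbientPoly d} (hq : q ∈ restrictTotalDegree (Option (Fin d)) ℝ n) :
        coneFunctional hd hγ (p * q) = 0 := by
      have h := horth.2 n n.lt_succ_self _ (mk_mem_polyDegreeLE hq)
      rw [coneInner_mk] at h
      exact (mul_eq_zero.1 h).resolve_left (normConst_ne_zero hd hγ)
    refine polyEval_eq_zero_of_coneIntegral_mul_self hd hγ ?_ ξ ht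
    change coneFunctional hd hγ (w * w) = 0
    -- Only one factor is expanded: the other `w` is kept as a test polynomial of degree at most
    -- `n`, and so is its image under the operator after the symmetry step.
    nth_rewrite 1 [hwdef]
    rw [add_mul, smul_mul_assoc, map_add, map_smul, coneFunctional_coneOpPoly_mul,
      hzero hw, hzero (coneOpPoly_mem γ hw), smul_zero, add_zero]

end

end ConeOP

theorem mainTheorem8 (d : ℕ) (hd : 2 ≤ d) (γ : ℝ) (hγ : -1 < γ) (n : ℕ)
    (u : ConeOP.ConePoly d) (hu : u ∈ ConeOP.orthogonalPolys d (-1) γ n)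
    (ξ : Metric.sphere (0 : EuclideanSpace ℝ (Fin d)) 1) (t : ℝ) (ht : t ∈ Set.Ioc (0 : ℝ) 1) :
    ConeOP.coneOperator d γ (ConeOP.inCoords u) ξ t =
      -(n : ℝ) * ((n : ℝ) + γ + (d : ℝ) - 1) * ConeOP.inCoords u ξ t := by
  obtain ⟨p, hp, rfl⟩ := hu.1
  have h := ConeOP.polyEval_coneOpPoly_add_smul hd hγ hp hu ξ ⟨ht.1.le, ht.2⟩
  change ConeOP.coneOperator d γ (ConeOP.inCoords (Ideal.Quotient.mk (ConeOP.coneIdeal d) p)) ξ t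
    = _ * ConeOP.inCoords (Ideal.Quotient.mk (ConeOP.coneIdeal d) p) ξ t
  rw [ConeOP.coneOperator_inCoords_mk γ p ξ ht.1.ne', ConeOP.inCoords_mk]
  rw [map_add, map_smul, smul_eq_mul] at h
  linear_combination h
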